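/- Let $G$ be a $\sigma$-compact locally compact (Hausdorff) group with left Haar measure $\mu$, and let $\pi$ be an integrable representation of $G$ on a complex Hilbert space $\mathcal{H}$, i.e. an irreducible, strongly continuous unitary representation for which there is some $g_0 \neq 0$ with $\mathcal{W}_{g_0}g_0 \in L^1(G)$, where $\mathcal{W}_g f(x) := \langle f, \pi(x)g\rangle$ (inner product linear in the first argument). Fix an integrable vector $g$, i.e. $g \neq 0$ and $\mathcal{W}_g g \in L^1(G)$, and assume that $g$ is admissible, i.e. $\|\mathcal{W}_g g\|_{L^2(G)} = \|g\|$ (equivalently, $\|C_\pi g\| = 1$ for the Duflo–Moore operator $C_\pi$ of $\pi$; every integrable vector becomes admissible after multiplication by a positive constant). Let $\mathcal{H}^1 := \{f \in \mathcal{H} : \mathcal{W}_g f \in L^1(G)\}$ with norm $\|f\|_{\mathcal{H}^1} := \|\mathcal{W}_g f\|_{L^1(G)}$, let $\mathcal{R}$ be the space of bounded anti-linear functionals on $\mathcal{H}^1$, and for $\phi \in \mathcal{R}$ put $\mathcal{W}_g\phi(x) := \phi(\pi(x)g)$, $x \in G$. For $1 \le p \le \infty$ let $$\mathcal{C}o_p(G)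 := \{\phi \in \mathcal{R} : \mathcal{W}_g\phi \in L^p(G)\}, \qquad \|\phi\|_{\mathcal{C}o_p(G)} := \|\mathcal{W}_g\phi\|_{L^p(G)},$$ $$\mathcal{M}_p(G) := \{F \in L^p(G) : F = F * \mathcal{W}_g g\}, \qquad (F * K)(x) := \int_G F(y)K(y^{-1}x)\,d\mu(y).$$ Then for every $1 \le p \le \infty$ the extended wavelet transform $\phi \mapsto \mathcal{W}_g\phi$ is a linear isometric isomorphism from $\mathcal{C}o_p(G)$ onto $\mathcal{M}_p(G)$ (with the $L^p$-norm). -/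

import Mathlib

open MeasureTheory
open scoped ENNReal

namespace Coorbit

/-- A unitary representation of a topological group `G` on a complex Hilbert space `H`: a group
homomorphism into the unitary operators of `H`, strongly continuous. -/
structure UnitaryRep (G H : Type*) [Group G] [TopologicalSpace G]
    [NormedAddCommGroup H] [InnerProductSpace ℂ H] where
  /-- the underlying homomorphism into the group of unitary operators -/
  toHom : G →* (H ≃ₗᵢ[ℂ] H)
  continuous_apply : ∀ v : H, Continuous fun x : G => toHom x v

noncomputable section

variable {G H : Type*} [Group G] [TopologicalSpace G]
  [NormedAddCommGroup H] [InnerProductSpace ℂ H]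

/-- The only closed invariant subspaces are `{0}` and the whole space. -/
def UnitaryRep.IsIrreducible (π : UnitaryRep G H) : Prop :=
  ∀ K : Submodule ℂ H, IsClosed (K : Set H) → (∀ x : G, ∀ v ∈ K, π.toHom x v ∈ K) →
    K = ⊥ ∨ K = ⊤

/-- The wavelet transform `W_g f (x) = ⟨f, π(x) g⟩`, where the inner product of the text is linear
in its first argument (Mathlib's `inner` is linear in the second one). -/
def wavelet (π : UnitaryRep G H) (g f : H) (x : G) : ℂ :=
  inner ℂ (π.toHom x g) f

lemma continuous_wavelet (π : UnitaryRep G H) (g f : H) : Continuous (wavelet π g f) :=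
  (π.continuous_apply g).inner continuous_const

lemma norm_wavelet_le (π : UnitaryRep G H) (g f : H) (x : G) :
    ‖wavelet π g f x‖ ≤ ‖g‖ * ‖f‖ := by
  simpa [wavelet] using norm_inner_le_norm (𝕜 := ℂ) (π.toHom x g) f

lemma wavelet_apply_left (π : UnitaryRep G H) (g f : H) (y x : G) :
    wavelet π g (π.toHom y f) x = wavelet π g f (y⁻¹ * x) := by
  have h := (π.toHom y).inner_map_map (π.toHom (y⁻¹ * x) g) f
  have h2 : π.toHom y (π.toHom (y⁻¹ * x) g) = π.toHom x g := by
    change (π.toHom y * π.toHom (y⁻¹ * x)) g = _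
    rw [← map_mul, mul_inv_cancel_left]
  rw [h2] at h
  exact h

/-- `W_g g (y⁻¹ x)` as a function of `y`, up to complex conjugation. -/
lemma wavelet_self_inv_mul (π : UnitaryRep G H) (g : H) (x y : G) :
    wavelet π g g (y⁻¹ * x) = (starRingEnd ℂ) (wavelet π g g (x⁻¹ * y)) := by
  rw [← wavelet_apply_left, ← wavelet_apply_left, wavelet, wavelet, inner_conj_symm]

/-- The convolution `(F * K)(x) = ∫ F(y) K(y⁻¹ x) dμ(y)`. -/
def conv {G : Type*} [Group G] [MeasurableSpace G] (μ : Measure G) (F K : G → ℂ) (x : G) : ℂ :=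
  ∫ y, F y * K (y⁻¹ * x) ∂μ

lemma conv_congr_ae {G : Type*} [Group G] [MeasurableSpace G] (μ : Measure G) {F F' : G → ℂ} (h : F =ᵐ[μ] F') (K : G → ℂ) :
    conv μ F K = conv μ F' K := by
  ext x
  refine integral_congr_ae ?_
  filter_upwards [h] with y hy
  rw [hy]

variable [MeasurableSpace G]

/-- `g` belongs to the set of analyzing vectors: `W_g g ∈ L¹(G)`. -/
def IsAnalyzing (π : UnitaryRep G H) (μ : Measure G) (g : H) : Prop :=
  MemLp (wavelet π g g) 1 μ

/-- An integrable vector: a nonzero analyzing vector. -/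
def IsIntegrableVector (π : UnitaryRep G H) (μ : Measure G) (g : H) : Prop :=
  g ≠ 0 ∧ IsAnalyzing π μ g

/-- A representation is integrable if it is irreducible and has an integrable vector. -/
def UnitaryRep.IsIntegrable (π : UnitaryRep G H) (μ : Measure G) : Prop :=
  π.IsIrreducible ∧ ∃ g : H, IsIntegrableVector π μ g

/-- The admissibility condition `‖C_π g‖ = 1` for a nonzero square integrable vector `g` of an
irreducible representation, written without the Duflo–Moore operator `C_π`: by the orthogonality
relation `‖W_g f‖₂ = ‖f‖ ‖C_π g‖`, and `f = g` gives `‖C_π g‖ = ‖W_g g‖₂ / ‖g‖`. Only this single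
norm is prescribed; that `W_g` is then isometric from `H` to `L²(G)` is not part of the
definition. -/
def IsAdmissible (π : UnitaryRep G H) (μ : Measure G) (g : H) : Prop :=
  g ≠ 0 ∧ MemLp (wavelet π g g) 2 μ ∧ eLpNorm (wavelet π g g) 2 μ = ENNReal.ofReal ‖g‖

/-- The space of test vectors `H¹_g = {f ∈ H : W_g f ∈ L¹(G)}`. -/
def testVectors (π : UnitaryRep G H) (μ : Measure G) (g : H) : Submodule ℂ H where
  carrier := {f | MemLp (wavelet π g f) 1 μ}
  zero_mem' := by
    have : wavelet π g 0 = 0 := by ext x; simp [wavelet]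
    simp [this]
  add_mem' {a b} ha hb := by
    have : wavelet π g (a + b) = wavelet π g a + wavelet π g b := by
      ext x; exact inner_add_right _ _ _
    simpa [this] using MemLp.add ha hb
  smul_mem' c a ha := by
    have : wavelet π g (c • a) = c • wavelet π g a := by
      ext x; exact inner_smul_right _ _ _
    simpa [this] using MemLp.const_smul ha c

/-- The norm `‖f‖_{H¹_g} = ‖W_g f‖_{L¹(G)}`. -/
def testNorm (π : UnitaryRep G H) (μ : Measure G) (g : H) (f : testVectors π μ g) : ℝ :=
  (eLpNorm (wavelet π g (f : H)) 1 μ).toReal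

/-- The reservoir space: anti-linear functionals on `H¹_g` that are bounded for the norm of
`H¹_g`. -/
def reservoir (π : UnitaryRep G H) (μ : Measure G) (g : H) :
    Submodule ℂ (testVectors π μ g →ₗ⋆[ℂ] ℂ) where
  carrier := {φ | ∃ C : ℝ, ∀ f, ‖φ f‖ ≤ C * testNorm π μ g f}
  zero_mem' := ⟨0, by simp⟩
  add_mem' := by
    rintro a b ⟨C, hC⟩ ⟨D, hD⟩
    refine ⟨C + D, fun f => ?_⟩
    rw [add_mul]
    exact (norm_add_le (a f) (b f)).trans (add_le_add (hC f) (hD f))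
  smul_mem' := by
    rintro c a ⟨C, hC⟩
    refine ⟨‖c‖ * C, fun f => ?_⟩
    rw [LinearMap.smul_apply, norm_smul, mul_assoc]
    exact mul_le_mul_of_nonneg_left (hC f) (norm_nonneg c)

section Invariant

variable [IsTopologicalGroup G] [BorelSpace G]

/-- The test vectors are invariant under the representation. -/
lemma map_mem_testVectors (π : UnitaryRep G H) (μ : Measure G) [μ.IsMulLeftInvariant] (g : H)
    {f : H} (hf : f ∈ testVectors π μ g) (x : G) : π.toHom x f ∈ testVectors π μ g := by
  have h : wavelet π g (π.toHom x f) = wavelet π g f ∘ fun y => x⁻¹ * y := by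
    ext y; exact wavelet_apply_left π g f x y
  change MemLp (wavelet π g (π.toHom x f)) 1 μ
  rw [h]
  exact MemLp.comp_measurePreserving hf (measurePreserving_mul_left μ x⁻¹)

/-- The extended wavelet transform `W_w φ (x) = φ(π(x) w)` of an element `φ` of the reservoir with
respect to a test vector `w`. -/
def extWavelet (π : UnitaryRep G H) (μ : Measure G) [μ.IsMulLeftInvariant] (g : H)
    (w : testVectors π μ g) (φ : reservoir π μ g) (x : G) : ℂ :=
  (φ : testVectors π μ g →ₗ⋆[ℂ] ℂ) ⟨π.toHom x (w : H), map_mem_testVectors π μ g w.2 x⟩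

/-- An analyzing vector `g`, viewed as an element of `H¹_g`. -/
def analyzingVector (π : UnitaryRep G H) (μ : Measure G) (g : H) (hg : IsAnalyzing π μ g) :
    testVectors π μ g :=
  ⟨g, hg⟩

/-- The coorbit space `Co_p(G) = {φ in the reservoir : W_g φ ∈ L^p(G)}`. -/
def coorbit (π : UnitaryRep G H) (μ : Measure G) [μ.IsMulLeftInvariant] (g : H)
    (hg : IsAnalyzing π μ g) (p : ℝ≥0∞) : Submodule ℂ (reservoir π μ g) where
  carrier := {φ | MemLp (extWavelet π μ g (analyzingVector π μ g hg) φ) p μ}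
  zero_mem' := by
    have : extWavelet π μ g (analyzingVector π μ g hg) 0 = 0 := by
      ext x; simp [extWavelet]
    simp [this]
  add_mem' {a b} ha hb := by
    have : extWavelet π μ g (analyzingVector π μ g hg) (a + b) =
        extWavelet π μ g (analyzingVector π μ g hg) a +
          extWavelet π μ g (analyzingVector π μ g hg) b := by
      ext x; simp [extWavelet]
    simpa [this] using MemLp.add ha hb
  smul_mem' c a ha := by
    have : extWavelet π μ g (analyzingVector π μ g hg) (c • a) =
        c • extWavelet π μ g (analyzingVector π μ g hg) a := by
      ext x; simp [extWavelet]
    simpa [this] using MemLp.const_smul ha c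

/-- The norm `‖φ‖_{Co_p(G)} = ‖W_g φ‖_{L^p(G)}`. -/
def coorbitNorm (π : UnitaryRep G H) (μ : Measure G) [μ.IsMulLeftInvariant] (g : H)
    (hg : IsAnalyzing π μ g) (p : ℝ≥0∞) (φ : coorbit π μ g hg p) : ℝ :=
  (eLpNorm (extWavelet π μ g (analyzingVector π μ g hg) (φ : reservoir π μ g)) p μ).toReal

/-- The integral defining `F * W_g g` converges absolutely at every point if `F ∈ L^p(G)`. -/
lemma integrable_conv_wavelet (π : UnitaryRep G H) (μ : Measure G) [μ.IsMulLeftInvariant] (g : H)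
    (hg : IsAnalyzing π μ g) (p : ℝ≥0∞) (hp : 1 ≤ p) {F : G → ℂ} (hF : MemLp F p μ) (x : G) :
    Integrable (fun y => F y * wavelet π g g (y⁻¹ * x)) μ := by
  have hk : Integrable (fun y => wavelet π g g (y⁻¹ * x)) μ := by
    have h1 := MemLp.comp_measurePreserving hg (measurePreserving_mul_left μ x⁻¹)
    have h2 : Integrable (fun y => wavelet π g g (x⁻¹ * y)) μ := memLp_one_iff_integrable.mp h1
    have h3 : (fun y => wavelet π g g (y⁻¹ * x)) =
        fun y => (starRingEnd ℂ) (wavelet π g g (x⁻¹ * y)) := by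
      ext y; exact wavelet_self_inv_mul π g x y
    rw [h3]
    exact (LinearIsometryEquiv.integrable_comp_iff Complex.conjLIE).mpr h2
  rcases eq_or_ne p ∞ with rfl | hpt
  · exact MemLp.integrable_mul hF (memLp_one_iff_integrable.mpr hk)
  · have hp0 : p ≠ 0 := (zero_lt_one.trans_le hp).ne'
    have hFp : Integrable (fun y => ‖F y‖ ^ p.toReal) μ := hF.integrable_norm_rpow hp0 hpt
    have hp1 : 1 ≤ p.toReal := by
      simpa using ENNReal.toReal_mono hpt hp
    refine Integrable.mono' (hk.norm.add (hFp.mul_const (‖g‖ * ‖g‖)))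
      (hF.aestronglyMeasurable.mul hk.aestronglyMeasurable) (Filter.Eventually.of_forall fun y => ?_)
    have hb := norm_wavelet_le π g g (y⁻¹ * x)
    have h0 : 0 ≤ ‖F y‖ ^ p.toReal := Real.rpow_nonneg (norm_nonneg _) _
    have hle : ‖F y‖ ≤ 1 + ‖F y‖ ^ p.toReal := by
      rcases le_total ‖F y‖ 1 with h | h
      · linarith
      · have := Real.rpow_le_rpow_of_exponent_le h hp1
        rw [Real.rpow_one] at this
        linarith
    simp only [Pi.add_apply, norm_mul]
    nlinarith [mul_le_mul_of_nonneg_right hle (norm_nonneg (wavelet π g g (y⁻¹ * x))),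
      mul_le_mul_of_nonneg_left hb h0]

/-- The space `M_p(G) = {F ∈ L^p(G) : F = F * W_g g}`. -/
def reproducingSpace (π : UnitaryRep G H) (μ : Measure G) [μ.IsMulLeftInvariant] (g : H)
    (hg : IsAnalyzing π μ g) (p : ℝ≥0∞) [hp : Fact (1 ≤ p)] : Submodule ℂ (Lp ℂ p μ) where
  carrier := {F | (F : G → ℂ) =ᵐ[μ] conv μ F (wavelet π g g)}
  zero_mem' := by
    have h : conv μ ((0 : Lp ℂ p μ) : G → ℂ) (wavelet π g g) = 0 := by
      rw [conv_congr_ae μ (Lp.coeFn_zero ℂ p μ)]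
      ext x; simp [conv]
    change ((0 : Lp ℂ p μ) : G → ℂ) =ᵐ[μ] _
    rw [h]
    exact Lp.coeFn_zero ℂ p μ
  add_mem' {a b} ha hb := by
    have h : conv μ ((a + b : Lp ℂ p μ) : G → ℂ) (wavelet π g g) =
        conv μ a (wavelet π g g) + conv μ b (wavelet π g g) := by
      rw [conv_congr_ae μ (Lp.coeFn_add a b)]
      ext x
      simp only [conv, Pi.add_apply, add_mul]
      exact integral_add (integrable_conv_wavelet π μ g hg p hp.out (Lp.memLp a) x)
        (integrable_conv_wavelet π μ g hg p hp.out (Lp.memLp b) x)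
    change ((a + b : Lp ℂ p μ) : G → ℂ) =ᵐ[μ] _
    rw [h]
    exact (Lp.coeFn_add a b).trans (Filter.EventuallyEq.add ha hb)
  smul_mem' c a ha := by
    have h : conv μ ((c • a : Lp ℂ p μ) : G → ℂ) (wavelet π g g) =
        c • conv μ a (wavelet π g g) := by
      rw [conv_congr_ae μ (Lp.coeFn_smul c a)]
      ext x
      simp only [conv, Pi.smul_apply, smul_eq_mul, mul_assoc]
      exact integral_const_mul c _
    change ((c • a : Lp ℂ p μ) : G → ℂ) =ᵐ[μ] _
    rw [h]
    exact (Lp.coeFn_smul c a).trans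
      (Filter.EventuallyEq.const_smul (show (a : G → ℂ) =ᵐ[μ] conv μ a (wavelet π g g) from ha) c)

end Invariant

end

end Coorbit

/-! Everything rests on the reproducing formula. Schur's test for the kernel `⟨π(y)g, π(x)g⟩`, whose
row integrals all equal `‖W_g g‖₁` by left invariance, makes `V : f ↦ W_g f` bounded from `H` to
`L²`. The operator `V*V` commutes with `π`, so Schur's lemma makes it a scalar, and admissibility
makes that scalar 1. Hence `V` is isometric and `W_g f * W_g g = W_g f` (`conv_wavelet`).

For a test vector `f` the formula lifts to a Bochner integral in `L¹`: `W_g f` is the integral of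
`W_g f(y) • W_g(π(y)g)`. By Hahn–Banach an element `φ` of the reservoir is, up to conjugation, a
functional on `L¹`, and passes under this integral: `φ(f) = ∫ W_g φ · conj(W_g f)`
(`reservoir_apply_eq_integral`). This gives injectivity, and `f = π(x)g` gives `W_g φ = W_g φ * W_g
g`.

Conversely, every `F` in `M_p` is essentially bounded, so pairing `F` with `W_g f ∈ L¹` defines an
element of the reservoir whose transform is `F * W_g g = F`. The isometry is built into the norms.
-/

namespace Coorbit

/-! ### Schur's lemma through the continuous functional calculus -/

section Schur

variable {G H : Type*} [Group G] [TopologicalSpace G] [NormedAddCommGroup H]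
  [InnerProductSpace ℂ H]

lemma UnitaryRep.toHom_mul_apply (π : UnitaryRep G H) (x y : G) (v : H) :
    π.toHom (x * y) v = π.toHom x (π.toHom y v) := by
  rw [map_mul]; rfl

lemma UnitaryRep.inner_toHom_left (π : UnitaryRep G H) (x : G) (v w : H) :
    inner ℂ (π.toHom x v) w = inner ℂ v (π.toHom x⁻¹ w) := by
  rw [← (π.toHom x).inner_map_map v, ← π.toHom_mul_apply, mul_inv_cancel, map_one]
  rfl

/-- Schur's lemma for self-adjoint operators. -/
lemma UnitaryRep.IsIrreducible.eq_smul_one [CompleteSpace H] {π : UnitaryRep G H}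
    (hπ : π.IsIrreducible) (S : H →L[ℂ] H) (hS : IsSelfAdjoint S)
    (hcomm : ∀ x v, S (π.toHom x v) = π.toHom x (S v)) :
    ∃ c : ℝ, S = c • (1 : H →L[ℂ] H) := by
  -- `cfc f S` commutes with `π`, so its kernel is a closed invariant subspace: a nonzero `cfc f S`
  -- is injective.
  have hker : ∀ f : ℝ → ℝ, cfc f S ≠ 0 → ∀ v, cfc f S v = 0 → v = 0 := by
    intro f hf v hv
    have hinv : ∀ x : G, ∀ v, cfc f S (π.toHom x v) = π.toHom x (cfc f S v) := by
      intro x v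
      let U : H →L[ℂ] H := ((π.toHom x).toContinuousLinearEquiv : H →L[ℂ] H)
      have hU : Commute S U := by ext v; exact hcomm x v
      exact congrArg (fun A : H →L[ℂ] H => A v) (hU.cfc_real f).eq
    rcases hπ (LinearMap.ker (cfc f S : H →L[ℂ] H).toLinearMap)
      (ContinuousLinearMap.isClosed_ker _) (fun x v hv => by
        have hv' : cfc f S v = 0 := hv
        change cfc f S _ = 0
        rw [hinv, hv', map_zero]) with h | h
    · have : v ∈ LinearMap.ker (cfc f S : H →L[ℂ] H).toLinearMap := hv
      rw [h] at this
      exact this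
    · refine absurd ?_ hf
      ext w
      have : w ∈ LinearMap.ker (cfc f S : H →L[ℂ] H).toLinearMap := by rw [h]; trivial
      exact this
  have hne : ∀ f : ℝ → ℝ, Continuous f → ∀ t ∈ spectrum ℝ S, f t ≠ 0 → cfc f S ≠ 0 := by
    intro f hf t ht hft h0
    have h1 : f t ∈ spectrum ℝ (cfc f S) := by
      rw [cfc_map_spectrum f S hS hf.continuousOn]
      exact ⟨t, ht, rfl⟩
    rw [h0, spectrum.mem_iff, sub_zero] at h1
    by_contra
    exact h1 ((IsUnit.mk0 _ hft).map (algebraMap ℝ (H →L[ℂ] H)))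
  -- Two spectral points separated by `m` would make the positive and negative parts of `S - m` both
  -- nonzero, yet their product is 0, against injectivity.
  have hlt : ∀ a ∈ spectrum ℝ S, ∀ b ∈ spectrum ℝ S, ¬ a < b := by
    intro a ha b hb hab
    set m := (a + b) / 2 with hm
    have hc1 : Continuous fun t : ℝ => max (t - m) 0 := by fun_prop
    have hc2 : Continuous fun t : ℝ => max (m - t) 0 := by fun_prop
    have h1 := hne _ hc1 b hb (by rw [max_eq_left] <;> linarith)
    have h2 := hne _ hc2 a ha (by rw [max_eq_left] <;> linarith)
    have hmul : cfc (fun t : ℝ => max (t - m) 0) S * cfc (fun t : ℝ => max (m - t) 0) S = 0 := by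
      rw [← cfc_mul _ _ S hc1.continuousOn hc2.continuousOn]
      convert cfc_const_zero ℝ S using 2
      ext t
      rcases le_total t m with h | h
      · rw [max_eq_right (by linarith), zero_mul]
      · rw [max_eq_right (a := m - t) (by linarith), mul_zero]
    refine h2 ?_
    ext v
    exact hker _ h1 _ (congrArg (fun A : H →L[ℂ] H => A v) hmul)
  rcases (spectrum ℝ S).eq_empty_or_nonempty with h | ⟨c, hc⟩
  · refine ⟨0, ?_⟩
    rw [CFC.eq_algebraMap_of_spectrum_subset_singleton S (0 : ℝ) (by simp [h]) hS]
    simp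
  · refine ⟨c, ?_⟩
    rw [CFC.eq_algebraMap_of_spectrum_subset_singleton S c (fun t ht => ?_) hS,
      Algebra.algebraMap_eq_smul_one]
    exact le_antisymm (not_lt.1 (hlt c hc t ht)) (not_lt.1 (hlt t ht c hc))

end Schur

/-! ### Row integrals of the Gram kernel of the orbit -/

section Measurability

variable {G H : Type*} [Group G] [TopologicalSpace G] [MeasurableSpace G] [BorelSpace G]
  [NormedAddCommGroup H] [InnerProductSpace ℂ H]

lemma stronglyMeasurable_wavelet (π : UnitaryRep G H) (g f : H) :
    StronglyMeasurable (wavelet π g f) :=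
  (continuous_wavelet π g f).stronglyMeasurable

variable [IsTopologicalGroup G] (μ : Measure G) [μ.IsMulLeftInvariant]

lemma lintegral_enorm_inner_orbit (π : UnitaryRep G H) (g : H) (x : G) :
    ∫⁻ y, ‖(inner ℂ (π.toHom y g) (π.toHom x g) : ℂ)‖ₑ ∂μ = eLpNorm (wavelet π g g) 1 μ := by
  rw [eLpNorm_one_eq_lintegral_enorm,
    ← lintegral_mul_left_eq_self (fun y => ‖wavelet π g g y‖ₑ) x⁻¹]
  refine lintegral_congr fun y => ?_
  rw [← wavelet_apply_left]
  rfl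

end Measurability

/-! ### Schur's test for the synthesis operator -/

section Bounded

variable {G H : Type*} [Group G] [TopologicalSpace G] [SigmaCompactSpace G] [MeasurableSpace G]
  [NormedAddCommGroup H] [InnerProductSpace ℂ H]

/-- The range is a countable union of compact sets in a pseudometrizable space, hence separable.
This replaces second countability of `G` and separability of `H`. -/
lemma stronglyMeasurable_of_continuous_of_sigmaCompact {X E : Type*} [TopologicalSpace X]
    [SigmaCompactSpace X] [MeasurableSpace X] [OpensMeasurableSpace X] [TopologicalSpace E]
    [TopologicalSpace.PseudoMetrizableSpace E] {f : X → E} (hf : Continuous f) :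
    StronglyMeasurable f := by
  borelize E
  refine stronglyMeasurable_iff_measurable_separable.2 ⟨hf.measurable, ?_⟩
  let := TopologicalSpace.pseudoMetrizableSpacePseudoMetric E
  rw [← Set.image_univ, ← iUnion_compactCovering, Set.image_iUnion]
  exact TopologicalSpace.IsSeparable.iUnion fun n =>
    ((isCompact_compactCovering X n).image hf).isSeparable

variable [BorelSpace G]

lemma stronglyMeasurable_orbit (π : UnitaryRep G H) (g : H) :
    StronglyMeasurable fun x => π.toHom x g :=
  stronglyMeasurable_of_continuous_of_sigmaCompact (π.continuous_apply g)

/-- Joint continuity would not suffice: without second countability the Borel σ-algebra of `G × G`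
may exceed the product one. Measurability therefore comes from each orbit map separately. -/
lemma stronglyMeasurable_inner_orbit (π : UnitaryRep G H) (g : H) :
    StronglyMeasurable fun z : G × G => (inner ℂ (π.toHom z.1 g) (π.toHom z.2 g) : ℂ) :=
  ((stronglyMeasurable_orbit π g).comp_measurable measurable_fst).inner
    ((stronglyMeasurable_orbit π g).comp_measurable measurable_snd)

variable [IsTopologicalGroup G] (μ : Measure G) [μ.IsMulLeftInvariant]

variable [SFinite μ]

/-- Schur's test for the synthesis operator `F ↦ ∫ F(x) π(x) g dμ(x)`. -/
lemma enorm_integral_smul_orbit_sq_le [CompleteSpace H] (π : UnitaryRep G H) (g : H) {F : G → ℂ}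
    (hF : Measurable F) (hFi : Integrable F μ) :
    ‖∫ x, F x • π.toHom x g ∂μ‖ₑ ^ 2 ≤
      eLpNorm (wavelet π g g) 1 μ * ∫⁻ x, ‖F x‖ₑ ^ 2 ∂μ := by
  have hint : Integrable (fun x => F x • π.toHom x g) μ := by
    refine (hFi.norm.mul_const ‖g‖).mono'
      (hF.aestronglyMeasurable.smul (stronglyMeasurable_orbit π g).aestronglyMeasurable)
      (Filter.Eventually.of_forall fun x => ?_)
    rw [norm_smul, LinearIsometryEquiv.norm_map]
  set u := ∫ x, F x • π.toHom x g ∂μ with hu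
  set k : G → G → ℝ≥0∞ := fun x y => ‖(inner ℂ (π.toHom x g) (π.toHom y g) : ℂ)‖ₑ with hk
  have hkm : Measurable (Function.uncurry k) := (stronglyMeasurable_inner_orbit π g).measurable.enorm
  have hks : ∀ x y, k x y = k y x := fun x y => by
    simp only [hk]
    rw [← inner_conj_symm, RCLike.enorm_conj]
  have hinner : ∀ x y, ‖(inner ℂ (π.toHom x g) (π.toHom y g) : ℂ)‖ₑ = k x y := fun _ _ => rfl
  have hk1 : ∀ y, ∫⁻ x, k x y ∂μ = eLpNorm (wavelet π g g) 1 μ :=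
    lintegral_enorm_inner_orbit μ π g
  clear_value k
  have hFe : Measurable fun x => ‖F x‖ₑ := hF.enorm
  have hkm' : Measurable fun z : G × G => k z.2 z.1 := hkm.comp measurable_swap
  have hm1 : Measurable fun z : G × G => ‖F z.1‖ₑ ^ 2 * k z.2 z.1 :=
    ((hFe.comp measurable_fst).pow_const 2).mul hkm'
  have hm2 : Measurable fun z : G × G => ‖F z.2‖ₑ ^ 2 * k z.2 z.1 :=
    ((hFe.comp measurable_snd).pow_const 2).mul hkm'
  have hpt : ∀ y, ‖(inner ℂ u (π.toHom y g) : ℂ)‖ₑ ≤ ∫⁻ x, ‖F x‖ₑ * k x y ∂μ := by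
    intro y
    rw [← inner_conj_symm, RCLike.enorm_conj, hu, ← integral_inner hint]
    refine (enorm_integral_le_lintegral_enorm _).trans (lintegral_mono fun x => ?_)
    rw [inner_smul_right, enorm_mul, hks x y, hinner]
  have h1 : ‖u‖ₑ ^ 2 ≤ ∫⁻ y, ∫⁻ x, ‖F y‖ₑ * ‖F x‖ₑ * k x y ∂μ ∂μ := by
    have h2 : ‖u‖ₑ ^ 2 = ‖(inner ℂ u u : ℂ)‖ₑ := by
      rw [inner_self_eq_norm_sq_to_K, enorm_pow]
      simp [enorm_eq_nnnorm]
    rw [h2]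
    nth_rewrite 2 [hu]
    rw [← integral_inner hint]
    refine (enorm_integral_le_lintegral_enorm _).trans (lintegral_mono fun y => ?_)
    rw [inner_smul_right, enorm_mul]
    simp_rw [mul_assoc]
    rw [lintegral_const_mul' _ _ enorm_ne_top]
    exact mul_le_mul_right (hpt y) _
  have hA : ∫⁻ y, ∫⁻ x, ‖F y‖ₑ ^ 2 * k x y ∂μ ∂μ =
      eLpNorm (wavelet π g g) 1 μ * ∫⁻ x, ‖F x‖ₑ ^ 2 ∂μ := by
    rw [← lintegral_const_mul _ (hFe.pow_const 2)]
    refine lintegral_congr fun y => ?_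
    rw [lintegral_const_mul _ hkm.of_uncurry_right, mul_comm]
    rw [hk1]
  have hB : ∫⁻ y, ∫⁻ x, ‖F x‖ₑ ^ 2 * k x y ∂μ ∂μ =
      eLpNorm (wavelet π g g) 1 μ * ∫⁻ x, ‖F x‖ₑ ^ 2 ∂μ := by
    rw [← hA, lintegral_lintegral_swap]
    · simp_rw [hks]
    · exact hm2.aemeasurable
  -- AM–GM separates the variables; by symmetry of `k` both resulting double integrals equal the
  -- right-hand side.
  have hpair : ∀ y x, 2 * (‖F y‖ₑ * ‖F x‖ₑ * k x y) ≤
      ‖F y‖ₑ ^ 2 * k x y + ‖F x‖ₑ ^ 2 * k x y := fun y x => by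
    rw [← add_mul, ← mul_assoc, ← mul_assoc]
    refine mul_le_mul_left ?_ _
    have := two_mul_le_add_sq ‖F y‖₊ ‖F x‖₊
    simp only [enorm_eq_nnnorm]
    exact_mod_cast this
  have hadd : ∫⁻ y, ∫⁻ x, (‖F y‖ₑ ^ 2 * k x y + ‖F x‖ₑ ^ 2 * k x y) ∂μ ∂μ =
      2 * (eLpNorm (wavelet π g g) 1 μ * ∫⁻ x, ‖F x‖ₑ ^ 2 ∂μ) := by
    rw [two_mul]
    nth_rewrite 1 [← hA]
    rw [← hB, ← lintegral_add_left hm1.lintegral_prod_right']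
    refine lintegral_congr fun y => ?_
    exact lintegral_add_left (hm1.comp measurable_prodMk_left) _
  have hsum : 2 * ‖u‖ₑ ^ 2 ≤ 2 * (eLpNorm (wavelet π g g) 1 μ * ∫⁻ x, ‖F x‖ₑ ^ 2 ∂μ) := by
    rw [← hadd]
    refine (mul_le_mul_right h1 2).trans ?_
    rw [← lintegral_const_mul' _ _ (by simp)]
    refine lintegral_mono fun y => ?_
    rw [← lintegral_const_mul' _ _ (by simp)]
    exact lintegral_mono fun x => hpair y x
  exact (ENNReal.mul_le_mul_iff_right (by simp) (by simp)).1 hsum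

end Bounded

section Linearity

variable {G H : Type*} [Group G] [TopologicalSpace G] [NormedAddCommGroup H]
  [InnerProductSpace ℂ H]

lemma wavelet_add (π : UnitaryRep G H) (g a b : H) :
    wavelet π g (a + b) = wavelet π g a + wavelet π g b := by
  ext x; exact inner_add_right _ _ _

lemma wavelet_smul (π : UnitaryRep G H) (g : H) (c : ℂ) (a : H) :
    wavelet π g (c • a) = c • wavelet π g a := by
  ext x; exact inner_smul_right _ _ _

end Linearity

lemma eLpNorm_two_sq {α : Type*} [MeasurableSpace α] {μ : Measure α} {f : α → ℂ} : eLpNorm f 2 μ ^ 2 = ∫⁻ x, ‖f x‖ₑ ^ 2 ∂μ := by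
  have := eLpNorm_nnreal_pow_eq_lintegral (f := f) (μ := μ) (p := 2) (by simp)
  simpa using this

/-! ### The `L²` isometry and the reproducing formula -/

section Isometry

variable {G H : Type*} [Group G] [TopologicalSpace G] [IsTopologicalGroup G] [SigmaCompactSpace G]
  [MeasurableSpace G] [BorelSpace G] [NormedAddCommGroup H] [InnerProductSpace ℂ H]
  [CompleteSpace H] (μ : Measure G) [μ.IsMulLeftInvariant] [SigmaFinite μ]

/-- Duality with the synthesis bound. On a set `A` of finite measure, `N = ∫_A |W_g f|²` equals `⟨f,
u⟩` up to conjugation, where `u` synthesizes the truncated transform. Then `N² ≤ ‖f‖² ‖u‖² ≤ ‖f‖²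
‖W_g g‖₁ N`, and `N` is finite, so it cancels. Spanning sets exhaust `G`. -/
lemma lintegral_enorm_wavelet_sq_le (π : UnitaryRep G H) (g f : H) :
    ∫⁻ x, ‖wavelet π g f x‖ₑ ^ 2 ∂μ ≤ eLpNorm (wavelet π g g) 1 μ * ‖f‖ₑ ^ 2 := by
  have hm : Measurable (wavelet π g f) := (stronglyMeasurable_wavelet π g f).measurable
  have hset : ∀ A, MeasurableSet A → μ A < ∞ →
      ∫⁻ x in A, ‖wavelet π g f x‖ₑ ^ 2 ∂μ ≤ eLpNorm (wavelet π g g) 1 μ * ‖f‖ₑ ^ 2 := by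
    intro A hA hμA
    set F : G → ℂ := A.indicator (wavelet π g f) with hF
    set N := ∫⁻ x in A, ‖wavelet π g f x‖ₑ ^ 2 ∂μ with hN
    have hFm : Measurable F := hm.indicator hA
    have hwi : IntegrableOn (wavelet π g f) A μ :=
      Measure.integrableOn_of_bounded hμA.ne hm.aestronglyMeasurable
        (Filter.Eventually.of_forall (norm_wavelet_le π g f))
    have hFi : Integrable F μ := hwi.integrable_indicator hA
    have hNF : ∫⁻ x, ‖F x‖ₑ ^ 2 ∂μ = N := by
      rw [hN, ← lintegral_indicator hA]
      refine lintegral_congr fun x => ?_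
      by_cases hx : x ∈ A <;> simp [hF, hx]
    have hNtop : N ≠ ∞ := by
      refine ((lintegral_mono fun x => ?_).trans_lt
        (lt_of_eq_of_lt (lintegral_const ((‖g‖ₑ * ‖f‖ₑ) ^ 2)) ?_)).ne
      · have := norm_wavelet_le π g f x
        gcongr
        simp only [enorm_eq_nnnorm]
        exact_mod_cast this
      · rw [Measure.restrict_apply_univ]
        exact ENNReal.mul_lt_top (ENNReal.pow_lt_top (ENNReal.mul_lt_top (by simp) (by simp))) hμA
    have hschur := enorm_integral_smul_orbit_sq_le μ π g hFm hFi
    rw [hNF] at hschur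
    have hint : Integrable (fun x => F x • π.toHom x g) μ := by
      refine (hFi.norm.mul_const ‖g‖).mono'
        (hFm.aestronglyMeasurable.smul (stronglyMeasurable_orbit π g).aestronglyMeasurable)
        (Filter.Eventually.of_forall fun x => ?_)
      rw [norm_smul, LinearIsometryEquiv.norm_map]
    set u := ∫ x, F x • π.toHom x g ∂μ with hu
    have hfu : (inner ℂ f u : ℂ) = ((∫ x, ‖F x‖ ^ 2 ∂μ : ℝ) : ℂ) := by
      rw [hu, ← integral_inner hint, ← integral_complex_ofReal]
      refine integral_congr_ae (Filter.Eventually.of_forall fun x => ?_)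
      simp only
      rw [inner_smul_right, ← inner_conj_symm]
      by_cases hx : x ∈ A
      · simp only [hF, Set.indicator_of_mem hx, wavelet]
        rw [Complex.mul_conj, Complex.normSq_eq_norm_sq]
      · simp [hF, hx]
    have hNu : N = ‖(inner ℂ f u : ℂ)‖ₑ := by
      rw [hfu, ← hNF]
      have h0 : 0 ≤ ∫ x, ‖F x‖ ^ 2 ∂μ := integral_nonneg fun x => by positivity
      have h1 : ‖((∫ x, ‖F x‖ ^ 2 ∂μ : ℝ) : ℂ)‖ₑ = ENNReal.ofReal (∫ x, ‖F x‖ ^ 2 ∂μ) := by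
        rw [← ofReal_norm, Complex.norm_real, Real.norm_of_nonneg h0]
      rw [h1, integral_eq_lintegral_of_nonneg_ae (Filter.Eventually.of_forall fun x => by positivity)
        (hFm.norm.pow_const 2).aestronglyMeasurable]
      have h2 : ∀ x, ENNReal.ofReal (‖F x‖ ^ 2) = ‖F x‖ₑ ^ 2 := fun x => by
        rw [ENNReal.ofReal_pow (norm_nonneg _), ofReal_norm]
      simp_rw [h2]
      rw [ENNReal.ofReal_toReal (by rwa [hNF])]
    have hle : N ≤ ‖f‖ₑ * ‖u‖ₑ := by
      rw [hNu]
      have := nnnorm_inner_le_nnnorm (𝕜 := ℂ) f u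
      simp only [enorm_eq_nnnorm]
      exact_mod_cast this
    rcases eq_or_ne N 0 with h0 | h0
    · rw [h0]; exact zero_le
    · refine (ENNReal.mul_le_mul_iff_right h0 hNtop).1 ?_
      calc N * N ≤ (‖f‖ₑ * ‖u‖ₑ) * (‖f‖ₑ * ‖u‖ₑ) := mul_le_mul' hle hle
        _ = ‖f‖ₑ ^ 2 * ‖u‖ₑ ^ 2 := by ring
        _ ≤ ‖f‖ₑ ^ 2 * (eLpNorm (wavelet π g g) 1 μ * N) := mul_le_mul_right hschur _
        _ = _ := by ring
  rw [← setLIntegral_univ, ← iUnion_spanningSets μ, setLIntegral_iUnion_of_directed _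
    (monotone_spanningSets μ).directed_le]
  exact iSup_le fun n => hset _ (measurableSet_spanningSets μ n) (measure_spanningSets_lt_top μ n)

variable {μ} {π : UnitaryRep G H} {g : H}

lemma memLp_two_wavelet (hg : IsAnalyzing π μ g) (f : H) : MemLp (wavelet π g f) 2 μ := by
  refine ⟨(stronglyMeasurable_wavelet π g f).aestronglyMeasurable, ?_⟩
  rw [eLpNorm_lt_top_iff_lintegral_rpow_enorm_lt_top (by simp) (by simp)]
  refine lt_of_le_of_lt ?_ ((lintegral_enorm_wavelet_sq_le μ π g f).trans_lt
    (ENNReal.mul_lt_top hg.2 (by simp)))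
  simp

/-- The wavelet transform as a bounded operator from `H` to `L²(G)`. -/
noncomputable def waveletL2 (hg : IsAnalyzing π μ g) : H →L[ℂ] Lp ℂ 2 μ :=
  LinearMap.mkContinuous
    { toFun := fun f => (memLp_two_wavelet hg f).toLp
      map_add' := fun a b => by
        rw [← MemLp.toLp_add]
        congr 1
        exact wavelet_add π g a b
      map_smul' := fun c a => by
        rw [RingHom.id_apply, ← MemLp.toLp_const_smul]
        congr 1
        exact wavelet_smul π g c a }
    (Real.sqrt (eLpNorm (wavelet π g g) 1 μ).toReal) fun f => by
      change ‖(memLp_two_wavelet hg f).toLp‖ ≤ _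
      rw [Lp.norm_toLp]
      refine abs_le_of_sq_le_sq' ?_ (by positivity) |>.2
      rw [mul_pow, Real.sq_sqrt ENNReal.toReal_nonneg, ← ENNReal.toReal_pow, eLpNorm_two_sq]
      refine (ENNReal.toReal_mono (ENNReal.mul_ne_top hg.2.ne (by simp))
        (lintegral_enorm_wavelet_sq_le μ π g f)).trans_eq ?_
      simp

lemma waveletL2_coeFn (hg : IsAnalyzing π μ g) (f : H) :
    (waveletL2 hg f : G → ℂ) =ᵐ[μ] wavelet π g f :=
  (memLp_two_wavelet hg f).coeFn_toLp

lemma inner_waveletL2 (hg : IsAnalyzing π μ g) (f h : H) :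
    (inner ℂ (waveletL2 hg f) (waveletL2 hg h) : ℂ) =
      ∫ x, wavelet π g h x * starRingEnd ℂ (wavelet π g f x) ∂μ := by
  rw [L2.inner_def]
  refine integral_congr_ae ?_
  filter_upwards [waveletL2_coeFn hg f, waveletL2_coeFn hg h] with x h1 h2
  rw [h1, h2]
  rfl

lemma inner_waveletL2_toHom (hg : IsAnalyzing π μ g) (y : G) (f h : H) :
    (inner ℂ (waveletL2 hg (π.toHom y f)) (waveletL2 hg h) : ℂ) =
      inner ℂ (waveletL2 hg f) (waveletL2 hg (π.toHom y⁻¹ h)) := by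
  rw [inner_waveletL2, inner_waveletL2, ← integral_mul_left_eq_self _ y]
  refine integral_congr_ae (Filter.Eventually.of_forall fun x => ?_)
  simp only
  rw [wavelet_apply_left, wavelet_apply_left, inv_inv, inv_mul_cancel_left]

/-- The orthogonality relations for an admissible integrable vector. -/
lemma inner_waveletL2_of_isAdmissible (hirr : π.IsIrreducible) (hg : IsAnalyzing π μ g)
    (hadm : IsAdmissible π μ g) (f h : H) :
    (inner ℂ (waveletL2 hg f) (waveletL2 hg h) : ℂ) = inner ℂ f h := by
  set V := waveletL2 hg with hV
  set S : H →L[ℂ] H := (ContinuousLinearMap.adjoint V).comp V with hS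
  have hin : ∀ a b : H, (inner ℂ a (S b) : ℂ) = inner ℂ (V a) (V b) := fun a b =>
    ContinuousLinearMap.adjoint_inner_right V a (V b)
  have hself : IsSelfAdjoint S := by
    rw [ContinuousLinearMap.isSelfAdjoint_iff_isSymmetric]
    intro a b
    change (inner ℂ (S a) b : ℂ) = inner ℂ a (S b)
    rw [← inner_conj_symm, hin, hin, inner_conj_symm]
  obtain ⟨c, hc⟩ := hirr.eq_smul_one S hself fun x v => by
    refine ext_inner_left ℂ fun w => ?_
    have h1 := inner_waveletL2_toHom hg x⁻¹ w v
    rw [inv_inv] at h1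
    rw [hin, hV, ← h1, ← hV, ← hin, π.inner_toHom_left, inv_inv]
  have hform : ∀ a b : H, (inner ℂ (V a) (V b) : ℂ) = c * inner ℂ a b := fun a b => by
    rw [← hin, hc]
    change inner ℂ a ((c : ℝ) • b) = _
    rw [inner_smul_right_eq_smul, Complex.real_smul]
  have hnorm : ‖V g‖ = ‖g‖ := by
    change ‖(memLp_two_wavelet hg g).toLp‖ = _
    rw [Lp.norm_toLp, hadm.2.2, ENNReal.toReal_ofReal (norm_nonneg _)]
  -- The single norm prescribed by admissibility determines the scalar.
  have hc1 : (c : ℂ) = 1 := by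
    have h1 := hform g g
    rw [inner_self_eq_norm_sq_to_K, inner_self_eq_norm_sq_to_K, hnorm] at h1
    have h2 : ((‖g‖ : ℂ)) ^ 2 ≠ 0 := by
      simpa using hadm.1
    exact (mul_right_cancel₀ h2 ((one_mul _).trans h1)).symm
  rw [hform, hc1, one_mul]

/-- The reproducing formula `W_g f * W_g g = W_g f`. -/
lemma conv_wavelet (hirr : π.IsIrreducible) (hg : IsAnalyzing π μ g)
    (hadm : IsAdmissible π μ g) (f : H) :
    conv μ (wavelet π g f) (wavelet π g g) = wavelet π g f := by
  ext x
  have h1 := inner_waveletL2_of_isAdmissible hirr hg hadm (π.toHom x g) f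
  rw [inner_waveletL2] at h1
  refine Eq.trans ?_ h1
  refine integral_congr_ae (Filter.Eventually.of_forall fun y => ?_)
  simp only
  rw [wavelet_apply_left, wavelet_self_inv_mul]

end Isometry

/-! ### Test vectors inside `L¹` -/

section TestVectors

variable {G H : Type*} [Group G] [TopologicalSpace G] [MeasurableSpace G]
  [NormedAddCommGroup H] [InnerProductSpace ℂ H] {μ : Measure G} {π : UnitaryRep G H} {g : H}

lemma testVectors_memLp (f : testVectors π μ g) : MemLp (wavelet π g (f : H)) 1 μ := f.2

/-- The embedding `f ↦ W_g f` of the test vectors into `L¹(G)`. -/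
noncomputable def waveletL1 (π : UnitaryRep G H) (μ : Measure G) (g : H) :
    testVectors π μ g →ₗ[ℂ] Lp ℂ 1 μ where
  toFun f := (testVectors_memLp f).toLp
  map_add' a b := by
    rw [← MemLp.toLp_add]
    congr 1
    exact wavelet_add π g a b
  map_smul' c a := by
    rw [RingHom.id_apply, ← MemLp.toLp_const_smul]
    congr 1
    exact wavelet_smul π g c a

lemma waveletL1_coeFn (f : testVectors π μ g) :
    (waveletL1 π μ g f : G → ℂ) =ᵐ[μ] wavelet π g (f : H) :=
  (testVectors_memLp f).coeFn_toLp

lemma norm_waveletL1 (f : testVectors π μ g) : ‖waveletL1 π μ g f‖ = testNorm π μ g f :=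
  Lp.norm_toLp _ (testVectors_memLp f)

lemma testNorm_eq_integral (f : testVectors π μ g) :
    testNorm π μ g f = ∫ x, ‖wavelet π g (f : H) x‖ ∂μ := by
  rw [testNorm, eLpNorm_one_eq_lintegral_enorm,
    integral_norm_eq_lintegral_enorm (testVectors_memLp f).aestronglyMeasurable]

/-- These functionals identify a Bochner integral in `L¹` with a pointwise integral. -/
lemma exists_clm_setIntegral {X : Type*} [MeasurableSpace X] (ν : Measure X) (s : Set X) :
    ∃ T : Lp ℂ 1 ν →L[ℝ] ℂ, ∀ v, T v = ∫ x in s, v x ∂ν := by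
  refine ⟨L1.integralCLM.comp (LpToLpRestrictCLM X ℂ ℝ ν 1 s), fun v => ?_⟩
  rw [← integral_congr_ae (LpToLpRestrictCLM_coeFn ℝ s v), ← L1.integral_eq_integral, L1.integral_def]
  rfl

variable [IsTopologicalGroup G] [BorelSpace G] [μ.IsMulLeftInvariant]

/-- The orbit of an analyzing vector, inside the test vectors. -/
def orbit (hg : IsAnalyzing π μ g) (y : G) : testVectors π μ g :=
  ⟨π.toHom y g, map_mem_testVectors π μ g hg y⟩

lemma norm_waveletL1_orbit (hg : IsAnalyzing π μ g) (y : G) :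
    ‖waveletL1 π μ g (orbit hg y)‖ = ‖waveletL1 π μ g (analyzingVector π μ g hg)‖ := by
  rw [norm_waveletL1, norm_waveletL1, testNorm_eq_integral, testNorm_eq_integral]
  change ∫ x, ‖wavelet π g (π.toHom y g) x‖ ∂μ = ∫ x, ‖wavelet π g g x‖ ∂μ
  simp_rw [wavelet_apply_left]
  exact integral_mul_left_eq_self (fun x => ‖wavelet π g g x‖) y⁻¹

lemma extWavelet_apply (hg : IsAnalyzing π μ g) (φ : reservoir π μ g) (y : G) :
    extWavelet π μ g (analyzingVector π μ g hg) φ y =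
      (φ : testVectors π μ g →ₗ⋆[ℂ] ℂ) (orbit hg y) :=
  rfl

end TestVectors

/-! ### Extending reservoir elements to functionals on `L¹` -/

section Duality

variable {G H : Type*} [Group G] [TopologicalSpace G] [IsTopologicalGroup G] [SigmaCompactSpace G]
  [MeasurableSpace G] [BorelSpace G] [NormedAddCommGroup H] [InnerProductSpace ℂ H]
  [CompleteSpace H] {μ : Measure G} [μ.IsMulLeftInvariant] [SigmaFinite μ]
  {π : UnitaryRep G H} {g : H}

lemma waveletL1_injective (hirr : π.IsIrreducible) (hg : IsAnalyzing π μ g)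
    (hadm : IsAdmissible π μ g) : Function.Injective (waveletL1 π μ g) := by
  refine (injective_iff_map_eq_zero _).2 fun f hf => ?_
  have h0 : wavelet π g (f : H) =ᵐ[μ] 0 :=
    (waveletL1_coeFn f).symm.trans (by rw [hf]; exact Lp.coeFn_zero ℂ 1 μ)
  have h1 := inner_waveletL2_of_isAdmissible hirr hg hadm (f : H) (f : H)
  rw [inner_waveletL2, integral_congr_ae (g := fun _ => (0 : ℂ)), integral_zero] at h1
  · exact Subtype.ext (inner_self_eq_zero.1 h1.symm)
  · filter_upwards [h0] with x hx
    simp [hx]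

/-- Elements of the reservoir extend, up to conjugation, to functionals on `L¹(G)`. -/
lemma exists_dual_L1 (hirr : π.IsIrreducible) (hg : IsAnalyzing π μ g)
    (hadm : IsAdmissible π μ g) (φ : reservoir π μ g) :
    ∃ Φ : StrongDual ℂ (Lp ℂ 1 μ), ∀ f, (φ : testVectors π μ g →ₗ⋆[ℂ] ℂ) f =
      starRingEnd ℂ (Φ (waveletL1 π μ g f)) := by
  obtain ⟨φ, C, hC⟩ := φ
  let ψ : testVectors π μ g →ₗ[ℂ] ℂ :=
    { toFun := fun f => starRingEnd ℂ (φ f)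
      map_add' := fun a b => by rw [map_add, map_add]
      map_smul' := fun c a => by
        rw [LinearMap.map_smulₛₗ, smul_eq_mul, map_mul, Complex.conj_conj]; rfl }
  let e := LinearEquiv.ofInjective (waveletL1 π μ g) (waveletL1_injective hirr hg hadm)
  let Ψ : StrongDual ℂ (LinearMap.range (waveletL1 π μ g)) :=
    LinearMap.mkContinuous (ψ ∘ₗ e.symm.toLinearMap) C fun v => by
      obtain ⟨f, rfl⟩ := e.surjective v
      have h1 : ‖e f‖ = testNorm π μ g f := norm_waveletL1 f
      rw [h1]
      simpa [ψ] using hC f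
  -- Hahn–Banach moves the problem to the complete space `L¹`, so completeness of the test space is
  -- never needed.
  obtain ⟨Φ, hΦ, -⟩ := exists_extension_norm_eq _ Ψ
  refine ⟨Φ, fun f => ?_⟩
  have h2 : Φ (waveletL1 π μ g f) = ψ (e.symm (e f)) := hΦ (e f)
  rw [h2, e.symm_apply_apply]
  exact (Complex.conj_conj _).symm

end Duality

/-! ### Reconstruction from the extended wavelet transform -/

section Reconstruction

variable {G H : Type*} [Group G] [TopologicalSpace G] [IsTopologicalGroup G]
  [LocallyCompactSpace G] [MeasurableSpace G] [BorelSpace G] [NormedAddCommGroup H]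
  [InnerProductSpace ℂ H] {μ : Measure G} [μ.IsHaarMeasure] [μ.Regular]
  {π : UnitaryRep G H} {g : H}

/-- Translation is continuous in `L¹(G)`. -/
lemma continuous_waveletL1_orbit
    (hg : IsAnalyzing π μ g) : Continuous fun y => waveletL1 π μ g (orbit hg y) := by
  have h : ∀ y, waveletL1 π μ g (orbit hg y) =
      DomMulAct.mk y⁻¹ • waveletL1 π μ g (analyzingVector π μ g hg) := fun y => by
    change (testVectors_memLp (orbit hg y)).toLp = DomMulAct.mk y⁻¹ •
      (testVectors_memLp (analyzingVector π μ g hg)).toLp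
    rw [DomMulAct.mk_smul_toLp]
    refine MemLp.toLp_congr _ _ (Filter.Eventually.of_forall fun x => ?_)
    exact wavelet_apply_left π g g y x
  have : Fact ((1 : ℝ≥0∞) ≠ ∞) := ⟨by simp⟩
  simp_rw [h]
  exact (DomMulAct.continuous_mk.comp continuous_inv).smul continuous_const

variable [SigmaCompactSpace G]

lemma integrable_smul_waveletL1_orbit (hg : IsAnalyzing π μ g) (f : testVectors π μ g) :
    Integrable (fun y => wavelet π g (f : H) y • waveletL1 π μ g (orbit hg y)) μ := by
  refine ((memLp_one_iff_integrable.1 (testVectors_memLp f)).norm.mul_const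
    ‖waveletL1 π μ g (analyzingVector π μ g hg)‖).mono' ?_
    (Filter.Eventually.of_forall fun y => ?_)
  · exact (stronglyMeasurable_wavelet π g f).aestronglyMeasurable.smul
      (stronglyMeasurable_of_continuous_of_sigmaCompact
        (continuous_waveletL1_orbit hg)).aestronglyMeasurable
  · rw [norm_smul, norm_waveletL1_orbit]

variable [CompleteSpace H]

/-- The reproducing formula as a Bochner integral in `L¹(G)`. -/
lemma integral_smul_waveletL1_orbit (hirr : π.IsIrreducible) (hg : IsAnalyzing π μ g)
    (hadm : IsAdmissible π μ g) (f : testVectors π μ g) :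
    ∫ y, wavelet π g (f : H) y • waveletL1 π μ g (orbit hg y) ∂μ = waveletL1 π μ g f := by
  have hint := integrable_smul_waveletL1_orbit hg f
  refine Lp.ext (Integrable.ae_eq_of_forall_setIntegral_eq _ _ (L1.integrable_coeFn _)
    (L1.integrable_coeFn _) fun s hs _ => ?_)
  obtain ⟨T, hT⟩ := exists_clm_setIntegral μ s
  rw [← hT, ← T.integral_comp_comm hint]
  have hTy : ∀ y, T (wavelet π g (f : H) y • waveletL1 π μ g (orbit hg y)) =
      ∫ x in s, wavelet π g (f : H) y * wavelet π g g (y⁻¹ * x) ∂μ := by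
    intro y
    rw [hT]
    refine integral_congr_ae (ae_restrict_of_ae ?_)
    filter_upwards [Lp.coeFn_smul (wavelet π g (f : H) y) (waveletL1 π μ g (orbit hg y)),
      waveletL1_coeFn (orbit hg y)] with x h1 h2
    rw [h1, Pi.smul_apply, h2, smul_eq_mul]
    congr 1
    exact wavelet_apply_left π g g y x
  -- Fubini's hypothesis. The factor `W_g g(y⁻¹x)` is measurable as an inner product of two orbit
  -- maps, since multiplication need not be measurable for the product σ-algebra.
  have hprod : Integrable (fun z : G × G => wavelet π g (f : H) z.1 * wavelet π g g (z.1⁻¹ * z.2))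
      (μ.prod μ) := by
    have hsm : StronglyMeasurable
        fun z : G × G => wavelet π g (f : H) z.1 * wavelet π g g (z.1⁻¹ * z.2) := by
      refine ((stronglyMeasurable_wavelet π g (f : H)).comp_measurable measurable_fst).mul ?_
      convert (stronglyMeasurable_inner_orbit π g).comp_measurable measurable_swap using 2 with z
      exact (wavelet_apply_left π g g z.1 z.2).symm
    refine (integrable_prod_iff hsm.aestronglyMeasurable).2
      ⟨Filter.Eventually.of_forall fun y => ?_, ?_⟩
    · exact ((memLp_one_iff_integrable.1 hg).comp_mul_left y⁻¹).const_mul (wavelet π g (f : H) y)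
    · simp only [norm_mul]
      simp_rw [integral_const_mul, integral_mul_left_eq_self (fun x => ‖wavelet π g g x‖)]
      exact (memLp_one_iff_integrable.1 (testVectors_memLp f)).norm.mul_const _
  simp_rw [hTy]
  rw [integral_integral_swap]
  · rw [← integral_congr_ae (ae_restrict_of_ae (waveletL1_coeFn f).symm)]
    refine integral_congr_ae (Filter.Eventually.of_forall fun x => ?_)
    exact congrFun (conv_wavelet hirr hg hadm (f : H)) x
  · have := hprod.restrict (s := Set.univ ×ˢ s)
    rwa [← Measure.prod_restrict, Measure.restrict_univ] at this

/-- Elements of the reservoir are determined by their extended wavelet transform. -/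
lemma reservoir_apply_eq_integral (hirr : π.IsIrreducible) (hg : IsAnalyzing π μ g)
    (hadm : IsAdmissible π μ g) (φ : reservoir π μ g) (f : testVectors π μ g) :
    (φ : testVectors π μ g →ₗ⋆[ℂ] ℂ) f =
      ∫ y, extWavelet π μ g (analyzingVector π μ g hg) φ y *
        starRingEnd ℂ (wavelet π g (f : H) y) ∂μ := by
  obtain ⟨Φ, hΦ⟩ := exists_dual_L1 hirr hg hadm φ
  rw [hΦ, ← integral_smul_waveletL1_orbit hirr hg hadm f,
    ← Φ.integral_comp_comm (integrable_smul_waveletL1_orbit hg f), ← integral_conj]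
  refine integral_congr_ae (Filter.Eventually.of_forall fun y => ?_)
  simp only
  rw [map_smul, smul_eq_mul, map_mul, ← hΦ, mul_comm, extWavelet_apply]

/-- The integral formula for `φ`, taken at the test vector `π(x)g`; it holds at every `x`. -/
lemma extWavelet_eq_conv (hirr : π.IsIrreducible) (hg : IsAnalyzing π μ g)
    (hadm : IsAdmissible π μ g) (φ : reservoir π μ g) :
    extWavelet π μ g (analyzingVector π μ g hg) φ =
      conv μ (extWavelet π μ g (analyzingVector π μ g hg) φ) (wavelet π g g) := by
  ext x
  rw [extWavelet_apply, reservoir_apply_eq_integral hirr hg hadm]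
  refine integral_congr_ae (Filter.Eventually.of_forall fun y => ?_)
  simp only
  rw [wavelet_self_inv_mul, ← wavelet_apply_left]
  rfl

end Reconstruction

/-! ### From `M_p` back to the reservoir -/

section Surjectivity

variable {G H : Type*} [Group G] [TopologicalSpace G] [IsTopologicalGroup G]
  [MeasurableSpace G] [BorelSpace G] [NormedAddCommGroup H] [InnerProductSpace ℂ H]
  {μ : Measure G} [μ.IsMulLeftInvariant] {π : UnitaryRep G H} {g : H}

/-- Functions in `M_p(G)` are essentially bounded. -/
lemma exists_ae_bound_of_mem_reproducingSpace (hg : IsAnalyzing π μ g) (p : ℝ≥0∞)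
    [hp : Fact (1 ≤ p)] {F : Lp ℂ p μ} (hF : F ∈ reproducingSpace π μ g hg p) :
    ∃ C : ℝ, ∀ᵐ x ∂μ, ‖F x‖ ≤ C := by
  rcases eq_or_ne p ∞ with rfl | hpt
  · refine ⟨(eLpNormEssSup F μ).toReal, ?_⟩
    have hfin : eLpNormEssSup F μ ≠ ∞ := by
      rw [← eLpNorm_exponent_top]; exact Lp.eLpNorm_ne_top F
    filter_upwards [ae_le_eLpNormEssSup (f := (F : G → ℂ)) (μ := μ)] with x hx
    simpa using ENNReal.toReal_mono hfin hx
  have hp1 : 1 ≤ p.toReal := by simpa using ENNReal.toReal_mono hpt hp.out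
  have hFp : Integrable (fun y => ‖F y‖ ^ p.toReal) μ :=
    (Lp.memLp F).integrable_norm_rpow (zero_lt_one.trans_le hp.out).ne' hpt
  have hK : Integrable (fun y => ‖wavelet π g g y‖) μ := (memLp_one_iff_integrable.1 hg).norm
  -- In place of Hölder: `|F| ≤ 1 + |F|^p` and `|W_g g| ≤ ‖g‖²` bound the integrand by `|W_g g| +
  -- |F|^p ‖g‖²`, and left invariance makes its integral independent of `x`.
  refine ⟨(∫ y, ‖wavelet π g g y‖ ∂μ) + ∫ y, ‖F y‖ ^ p.toReal * (‖g‖ * ‖g‖) ∂μ, ?_⟩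
  filter_upwards [show (F : G → ℂ) =ᵐ[μ] conv μ F (wavelet π g g) from hF] with x hx
  rw [hx, ← integral_mul_left_eq_self (fun y => ‖wavelet π g g y‖) x⁻¹,
    ← integral_add (hK.comp_mul_left x⁻¹) (hFp.mul_const _)]
  refine norm_integral_le_of_norm_le ((hK.comp_mul_left x⁻¹).add (hFp.mul_const _))
    (Filter.Eventually.of_forall fun y => ?_)
  rw [wavelet_self_inv_mul, norm_mul, RCLike.norm_conj]
  have hb := norm_wavelet_le π g g (x⁻¹ * y)
  have h0 : 0 ≤ ‖F y‖ ^ p.toReal := Real.rpow_nonneg (norm_nonneg _) _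
  have hle : ‖F y‖ ≤ 1 + ‖F y‖ ^ p.toReal := by
    rcases le_total ‖F y‖ 1 with h | h
    · linarith
    · have := Real.rpow_le_rpow_of_exponent_le h hp1
      rw [Real.rpow_one] at this
      linarith
  nlinarith [mul_le_mul_of_nonneg_right hle (norm_nonneg (wavelet π g g (x⁻¹ * y))),
    mul_le_mul_of_nonneg_left hb h0]

/-- The functional is `f ↦ ∫ F · conj(W_g f)`, bounded by `C` through the `L¹`–`L^∞` pairing. On
`π(x)g` it becomes the convolution because `W_g g(y⁻¹x)` is the conjugate of `W_g g(x⁻¹y)`. -/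
lemma exists_reservoir_of_ae_bound (hg : IsAnalyzing π μ g) {F : G → ℂ}
    (hFm : AEStronglyMeasurable F μ) {C : ℝ} (hC : ∀ᵐ x ∂μ, ‖F x‖ ≤ C) :
    ∃ φ : reservoir π μ g,
      extWavelet π μ g (analyzingVector π μ g hg) φ = conv μ F (wavelet π g g) := by
  have hW : ∀ f : testVectors π μ g, Integrable (wavelet π g (f : H)) μ := fun f =>
    memLp_one_iff_integrable.1 (testVectors_memLp f)
  have hint : ∀ f : testVectors π μ g,
      Integrable (fun y => F y * starRingEnd ℂ (wavelet π g (f : H) y)) μ := fun f =>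
    ((LinearIsometryEquiv.integrable_comp_iff Complex.conjLIE).2 (hW f)).bdd_mul hFm hC
  let φ : testVectors π μ g →ₗ⋆[ℂ] ℂ :=
    { toFun := fun f => ∫ y, F y * starRingEnd ℂ (wavelet π g (f : H) y) ∂μ
      map_add' := fun a b => by
        rw [← integral_add (hint a) (hint b)]
        congr 1
        ext y
        rw [Submodule.coe_add, wavelet_add, Pi.add_apply, map_add, mul_add]
      map_smul' := fun c a => by
        rw [smul_eq_mul, ← integral_const_mul]
        congr 1
        ext y
        rw [Submodule.coe_smul, wavelet_smul, Pi.smul_apply, smul_eq_mul, map_mul]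
        ring }
  refine ⟨⟨φ, C, fun f => ?_⟩, ?_⟩
  · rw [testNorm_eq_integral, ← integral_const_mul]
    refine norm_integral_le_of_norm_le ((hW f).norm.const_mul C) ?_
    filter_upwards [hC] with y hy
    rw [norm_mul, RCLike.norm_conj]
    exact mul_le_mul_of_nonneg_right hy (norm_nonneg _)
  · ext x
    refine integral_congr_ae (Filter.Eventually.of_forall fun y => ?_)
    simp only
    rw [wavelet_self_inv_mul, ← wavelet_apply_left]
    rfl

end Surjectivity

/-- The correspondence principle: the extended wavelet transform is an isometric isomorphism of
`Co_p(G)` onto `M_p(G)`. -/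
theorem exists_linearEquiv_coorbit_reproducingSpace {G H : Type*} [Group G] [TopologicalSpace G]
    [IsTopologicalGroup G] [LocallyCompactSpace G] [SigmaCompactSpace G] [MeasurableSpace G]
    [BorelSpace G] [NormedAddCommGroup H] [InnerProductSpace ℂ H] [CompleteSpace H]
    (μ : Measure G) [μ.IsHaarMeasure] [μ.Regular] (π : UnitaryRep G H) (hirr : π.IsIrreducible)
    (g : H) (hg : IsAnalyzing π μ g) (hadm : IsAdmissible π μ g) (p : ℝ≥0∞) [Fact (1 ≤ p)] :
    ∃ e : coorbit π μ g hg p ≃ₗ[ℂ] reproducingSpace π μ g hg p,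
      ∀ φ : coorbit π μ g hg p,
        ((e φ : Lp ℂ p μ) : G → ℂ) =ᵐ[μ]
            extWavelet π μ g (analyzingVector π μ g hg) (φ : reservoir π μ g) ∧
          ‖(e φ : Lp ℂ p μ)‖ = coorbitNorm π μ g hg p φ := by
  have hmem (φ : coorbit π μ g hg p) :
      MemLp (extWavelet π μ g (analyzingVector π μ g hg) (φ : reservoir π μ g)) p μ := φ.2
  let T : coorbit π μ g hg p →ₗ[ℂ] reproducingSpace π μ g hg p :=
    { toFun := fun φ => ⟨(hmem φ).toLp, by
        change ((hmem φ).toLp : G → ℂ) =ᵐ[μ] conv μ ((hmem φ).toLp) (wavelet π g g)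
        rw [conv_congr_ae μ (hmem φ).coeFn_toLp, ← extWavelet_eq_conv hirr hg hadm]
        exact (hmem φ).coeFn_toLp⟩
      map_add' := fun a b => Subtype.ext (MemLp.toLp_add (hmem a) (hmem b))
      map_smul' := fun c a => Subtype.ext (MemLp.toLp_const_smul c (hmem a)) }
  have hT (φ) : (T φ : Lp ℂ p μ) = (hmem φ).toLp := rfl
  -- The integral formula sees only the a.e. class of `W_g φ`.
  have hinj : Function.Injective T := by
    refine (injective_iff_map_eq_zero _).2 fun φ hφ => ?_
    have h0 : extWavelet π μ g (analyzingVector π μ g hg) (φ : reservoir π μ g) =ᵐ[μ] 0 := by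
      refine (hmem φ).coeFn_toLp.symm.trans ?_
      rw [← hT, hφ]
      exact Lp.coeFn_zero ℂ p μ
    refine Subtype.ext (Subtype.ext (LinearMap.ext fun f => ?_))
    rw [reservoir_apply_eq_integral hirr hg hadm, integral_congr_ae (g := fun _ => (0 : ℂ)),
      integral_zero]
    · rfl
    · filter_upwards [h0] with x hx
      simp [hx]
  have hsurj : Function.Surjective T := by
    rintro ⟨F, hF⟩
    obtain ⟨C, hC⟩ := exists_ae_bound_of_mem_reproducingSpace hg p hF
    obtain ⟨φ, hφ⟩ := exists_reservoir_of_ae_bound hg (Lp.aestronglyMeasurable F) hC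
    have hae : (F : G → ℂ) =ᵐ[μ] extWavelet π μ g (analyzingVector π μ g hg) φ := by
      rw [hφ]; exact hF
    let φ' : coorbit π μ g hg p := ⟨φ, (memLp_congr_ae hae).1 (Lp.memLp F)⟩
    refine ⟨φ', Subtype.ext (Lp.ext ?_)⟩
    exact (hmem φ').coeFn_toLp.trans hae.symm
  exact ⟨LinearEquiv.ofBijective T ⟨hinj, hsurj⟩, fun φ =>
    ⟨(hmem φ).coeFn_toLp, Lp.norm_toLp _ (hmem φ)⟩⟩

end Coorbit

theorem theorem3 {G H : Type*} [Group G] [TopologicalSpace G] [IsTopologicalGroup G] [T2Space G]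
    [LocallyCompactSpace G] [SigmaCompactSpace G] [MeasurableSpace G] [BorelSpace G]
    [NormedAddCommGroup H] [InnerProductSpace ℂ H] [CompleteSpace H]
    (μ : MeasureTheory.Measure G) [μ.IsHaarMeasure] [μ.Regular]
    (π : Coorbit.UnitaryRep G H) (hπ : π.IsIntegrable μ)
    (g : H) (hg : Coorbit.IsIntegrableVector π μ g) (hadm : Coorbit.IsAdmissible π μ g)
    (p : ENNReal) [Fact (1 ≤ p)] :
    ∃ e : Coorbit.coorbit π μ g hg.2 p ≃ₗ[ℂ] Coorbit.reproducingSpace π μ g hg.2 p,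
      ∀ φ : Coorbit.coorbit π μ g hg.2 p,
        ((e φ : MeasureTheory.Lp ℂ p μ) : G → ℂ) =ᵐ[μ]
            Coorbit.extWavelet π μ g (Coorbit.analyzingVector π μ g hg.2)
              (φ : Coorbit.reservoir π μ g) ∧
          ‖(e φ : MeasureTheory.Lp ℂ p μ)‖ = Coorbit.coorbitNorm π μ g hg.2 p φ := by
  exact Coorbit.exists_linearEquiv_coorbit_reproducingSpace μ π hπ.1 g hg.2 hadm p
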